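/- Let $n$ be a dimension, $H:\mathbb R^n\to\mathbb R$ a locally Lipschitz function, and consider the equation $$u_t+H(\nabla u)+(-\Delta)^{1/2}u=0\qquad(\ast)$$ in $\mathbb R^n\times(0,\infty)$, where $$(-\Delta)^{1/2}f(x)=C_n\ \mathrm{p.v.}\!\int_{\mathbb R^n}\frac{f(x)-f(x+y)}{|y|^{n+1}}\,dy,\qquad C_n=\frac{\Gamma((n+1)/2)}{\pi^{(n+1)/2}}.$$ An upper (resp. lower) semicontinuous function $u:\mathbb R^n\times[0,\infty)\to\mathbb R$ is a viscosity subsolution (resp. supersolution) of $(\ast)$ if, whenever $\varphi$ is a $C^2$ function, $x\in\mathbb R^n$, $t>0$ and $r>0$ are such that $\varphi(x,t)=u(x,t)$ and $\varphi(y,s)\ge u(y,s)$ (resp. $\varphi(y,s)\le u(y,s)$) for all $(y,s)$ with $|x-y|<r$, $t-r<s\le t$ and $s\ge 0$, the function $w$ equal to $\varphi$ in $B_r(x)\times(t-r,t+r)$ and to $u$ elsewhere is such that $(-\Delta)^{1/2}w(x,t)$ is well defined and finite, and $w_t+H(\nabla w)+(-\Delta)^{1/2}w\le 0$ (resp. $\ge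 0$) at $(x,t)$. Let $u$ be a viscosity subsolution and $v$ a viscosity supersolution of $(\ast)$ such that, for every $T>0$, $u$ is bounded above and $v$ is bounded below on $\mathbb R^n\times[0,T]$. Assume that for every $\varepsilon>0$ there is a $\delta>0$ such that $$u(x,t)\le v(y,s)+\varepsilon\qquad\text{whenever } |x-y|<\delta,\ 0\le t<\delta,\ 0\le s<\delta.$$ Then $u\le v$ in $\mathbb R^n\times[0,\infty)$. -/

import Mathlib

open Set Filter Topology MeasureTheory

noncomputable section

/-- The space `ℝⁿ` with its Euclidean norm. -/
abbrev Space (n : ℕ) : Type := EuclideanSpace ℝ (Fin n)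

/-- The normalizing constant `C_{n,1/2} = Γ((n+1)/2) / π^((n+1)/2)` of the half Laplacian on `ℝⁿ`. -/
def halfLaplacianConst (n : ℕ) : ℝ :=
  Real.Gamma (((n : ℝ) + 1) / 2) / Real.pi ^ (((n : ℝ) + 1) / 2)

/-- `HasHalfLaplacian f x L`: the singular integral
`C_{n,1/2} PV ∫ (f x - f (x + y)) / |y|^(n+1) dy` defining `(-Δ)^{1/2} f (x)` exists as a principal
value (with absolutely convergent truncated integrals) and is equal to the real number `L`. -/
def HasHalfLaplacian {n : ℕ} (f : Space n → ℝ) (x : Space n) (L : ℝ) : Prop :=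
  (∀ ρ : ℝ, 0 < ρ →
    IntegrableOn (fun y : Space n => (f x - f (x + y)) / ‖y‖ ^ (n + 1)) {y | ρ < ‖y‖} volume) ∧
  Tendsto
    (fun ρ : ℝ => halfLaplacianConst n *
      ∫ y in {y : Space n | ρ < ‖y‖}, (f x - f (x + y)) / ‖y‖ ^ (n + 1))
    (𝓝[>] 0) (𝓝 L)

/-- The closed half space `ℝⁿ × [0, ∞)`. -/
def spaceTime (n : ℕ) : Set (Space n × ℝ) := {z | 0 ≤ z.2}

/-- `φ` touches `u` from above at `(x, t)`, in the parabolic cylinder of size `r`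
(only the times `s ≤ t` matter). -/
def TouchesFromAbove {n : ℕ} (φ u : Space n × ℝ → ℝ) (x : Space n) (t r : ℝ) : Prop :=
  φ (x, t) = u (x, t) ∧
  ∀ (y : Space n) (s : ℝ), ‖x - y‖ < r → t - r < s → s ≤ t → 0 ≤ s → u (y, s) ≤ φ (y, s)

/-- `φ` touches `u` from below at `(x, t)`, in the parabolic cylinder of size `r`. -/
def TouchesFromBelow {n : ℕ} (φ u : Space n × ℝ → ℝ) (x : Space n) (t r : ℝ) : Prop :=
  φ (x, t) = u (x, t) ∧
  ∀ (y : Space n) (s : ℝ), ‖x - y‖ < r → t - r < s → s ≤ t → 0 ≤ s → φ (y, s) ≤ u (y, s)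

open Classical in
/-- The function equal to `φ` in `B_r(x) × (t - r, t + r)` and to `u` elsewhere. -/
def glue {n : ℕ} (φ u : Space n × ℝ → ℝ) (x : Space n) (t r : ℝ) : Space n × ℝ → ℝ :=
  fun z => if ‖x - z.1‖ < r ∧ t - r < z.2 ∧ z.2 < t + r then φ z else u z

/-- `w_t + H(∇w) + (-Δ)^{1/2} w` is well defined at `(x, t)` and equal to `a`
(used for `w` which is `C²` near `(x, t)`). -/
def HasOperatorValue {n : ℕ} (H : Space n → ℝ) (w : Space n × ℝ → ℝ)
    (x : Space n) (t a : ℝ) : Prop :=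
  ∃ L : ℝ, HasHalfLaplacian (fun y => w (y, t)) x L ∧
    a = deriv (fun s => w (x, s)) t + H (gradient (fun y => w (y, t)) x) + L

/-- Viscosity subsolution of `u_t + H(∇u) + (-Δ)^{1/2} u = 0` in `ℝⁿ × (0, ∞)`; only the values of
`u` on `ℝⁿ × [0, ∞)` matter. -/
def IsViscositySubsolution {n : ℕ} (H : Space n → ℝ) (u : Space n × ℝ → ℝ) : Prop :=
  UpperSemicontinuousOn u (spaceTime n) ∧
  ∀ (φ : Space n × ℝ → ℝ) (x : Space n) (t r : ℝ), ContDiff ℝ 2 φ → 0 < t → 0 < r →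
    TouchesFromAbove φ u x t r → ∃ a : ℝ, HasOperatorValue H (glue φ u x t r) x t a ∧ a ≤ 0

/-- Viscosity supersolution of `u_t + H(∇u) + (-Δ)^{1/2} u = 0` in `ℝⁿ × (0, ∞)`. -/
def IsViscositySupersolution {n : ℕ} (H : Space n → ℝ) (u : Space n × ℝ → ℝ) : Prop :=
  LowerSemicontinuousOn u (spaceTime n) ∧
  ∀ (φ : Space n × ℝ → ℝ) (x : Space n) (t r : ℝ), ContDiff ℝ 2 φ → 0 < t → 0 < r →
    TouchesFromBelow φ u x t r → ∃ a : ℝ, HasOperatorValue H (glue φ u x t r) x t a ∧ 0 ≤ a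

end

/-!
The comparison principle is proved by doubling variables. If `u (x₀, T) > v (x₀, T)`, the functional

  `u (x, t) - v (y, s) - |x - y|² / (2ε) - (t - s)² / (2ε) - η t - penalty M δ x`

attains a positive maximum over `(ℝⁿ × [0, T])²`, because `penalty M δ` is close to `M` at infinity
and `M` exceeds `sup u - inf v` (`exists_isMax_doubled`). For small `ε` the initial condition forces
both times of the maximum to be positive; since only the past matters in the definition of a
solution, the final time `T` needs no special treatment.

Both equations can then be tested at the maximum, with `u` and `v` replaced by the test functions in
balls of radius `r`. Outside these balls the half Laplacians are compared through the maximum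
property itself, applied to the points `x + z` and `y + z`, so that only the increment of the
penalty is left; inside them, one has quadratic polynomials and the penalty. The penalty is
semiconcave with constant of order `δ` and bounded by `M`, and by the symmetry of the kernel its
linear part does not contribute. Hence (`le_of_isMax_doubled`) the difference of the half Laplacians
is at most

  `M δ ∫_{|z| < A} |z|^(1 - n) + ε⁻¹ ∫_{|z| < r} |z|^(1 - n) + M ∫_{|z| ≥ A} |z|^(-n - 1)`

up to the factor `C_n`. Subtracting the equations leaves `η` plus the variation of `H` between
`p = (x - y) / ε` and `p + ∇ penalty`. For fixed `ε`, `p` is bounded and the gradient of the penalty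
is at most `M √δ`, so continuity of `H` suffices. The parameters are chosen in the order
`M, η, ε, A, δ, r`; the maximum point does not depend on `r`.
-/

/-! ### Integrability of the kernel `‖z‖ ^ (-(n + 1))` -/

theorem integrableOn_kernel_far (n : ℕ) {A : ℝ} (hA : 0 < A) :
    IntegrableOn (fun z : Space n => 1 / ‖z‖ ^ (n + 1)) {z | A ≤ ‖z‖} volume := by
  have hint : Integrable (fun z : Space n =>
      (1 + 1 / A) ^ (n + 1) * (1 + ‖z‖) ^ (-((n : ℝ) + 1))) volume := by
    refine (integrable_one_add_norm ?_).const_mul _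
    simp
  refine Integrable.mono' hint.integrableOn
    (Measurable.aestronglyMeasurable (by fun_prop)) ?_
  refine (ae_restrict_iff' (measurableSet_le measurable_const measurable_norm)).2
    (Eventually.of_forall fun z hz => ?_)
  have hz' : A ≤ ‖z‖ := hz
  have hz0 : 0 < ‖z‖ := hA.trans_le hz'
  have hle : 1 + ‖z‖ ≤ (1 + 1 / A) * ‖z‖ := by
    have : 1 ≤ 1 / A * ‖z‖ := by
      rw [one_div, inv_mul_eq_div]; exact (one_le_div hA).2 hz'
    linarith
  have hpow : (1 + ‖z‖) ^ (n + 1) ≤ (1 + 1 / A) ^ (n + 1) * ‖z‖ ^ (n + 1) := by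
    rw [← mul_pow]; exact pow_le_pow_left₀ (by positivity) hle _
  have hrpow : (1 + ‖z‖) ^ (-((n : ℝ) + 1)) = ((1 + ‖z‖) ^ (n + 1))⁻¹ := by
    rw [Real.rpow_neg (by positivity)]
    norm_cast
  rw [Real.norm_of_nonneg (by positivity), hrpow, ← div_eq_mul_inv,
    div_le_div_iff₀ (by positivity) (by positivity), one_mul]
  exact hpow

theorem integrableOn_kernel_near (n : ℕ) (A : ℝ) :
    IntegrableOn (fun z : Space n => ‖z‖ ^ 2 / ‖z‖ ^ (n + 1)) (Metric.ball 0 A) volume := by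
  rcases Nat.eq_zero_or_pos n with rfl | hn
  · have : ∀ z : Space 0, z = 0 := fun z => Subsingleton.elim _ _
    have h0 : (fun z : Space 0 => ‖z‖ ^ 2 / ‖z‖ ^ (0 + 1)) = fun _ => 0 := by
      funext z; simp [this z]
    rw [h0]
    exact integrableOn_zero
  · have : NeZero n := ⟨hn.ne'⟩
    rw [integrableOn_fun_norm_addHaar volume (f := fun y : ℝ => y ^ 2 / y ^ (n + 1))]
    have h1 : IntegrableOn (fun _ : ℝ => (1 : ℝ)) (Ioo 0 A) volume := by simp
    refine h1.congr_fun (fun y hy => ?_) measurableSet_Ioo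
    have hy0 : y ≠ 0 := hy.1.ne'
    obtain ⟨m, rfl⟩ : ∃ m, n = m + 1 := ⟨n - 1, by omega⟩
    simp only [finrank_euclideanSpace, Fintype.card_fin, Nat.add_sub_cancel, smul_eq_mul]
    field_simp
    ring

/-- The mass of the kernel far from the origin is small. -/
theorem exists_setIntegral_kernel_far_lt (n : ℕ) {e : ℝ} (he : 0 < e) :
    ∃ A : ℝ, 0 < A ∧ ∫ z in {z : Space n | A ≤ ‖z‖}, 1 / ‖z‖ ^ (n + 1) < e := by
  have h := Antitone.tendsto_setIntegral (μ := (volume : Measure (Space n)))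
    (s := fun k : ℕ => {z : Space n | (k : ℝ) + 1 ≤ ‖z‖}) (f := fun z => 1 / ‖z‖ ^ (n + 1))
    (fun i => measurableSet_le measurable_const measurable_norm)
    (fun i j hij z hz => by
      have : (i : ℝ) ≤ j := by exact_mod_cast hij
      simp only [mem_ofPred_eq] at hz ⊢
      linarith)
    (integrableOn_kernel_far n (by positivity))
  have hempty : (⋂ k : ℕ, {z : Space n | (k : ℝ) + 1 ≤ ‖z‖}) = ∅ := by
    refine eq_empty_of_forall_notMem fun z hz => ?_
    obtain ⟨k, hk⟩ := exists_nat_gt ‖z‖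
    have := mem_iInter.1 hz k
    simp only [mem_ofPred_eq] at this
    linarith
  rw [hempty, Measure.restrict_empty, integral_zero_measure] at h
  obtain ⟨k, hk⟩ := (h.eventually (gt_mem_nhds he)).exists
  exact ⟨k + 1, by positivity, hk⟩

/-- The second moment of the kernel near the origin is small. -/
theorem exists_setIntegral_kernel_near_lt (n : ℕ) {e R : ℝ} (he : 0 < e) (hR : 0 < R) :
    ∃ r : ℝ, 0 < r ∧ r < R ∧
      ∫ z in Metric.ball (0 : Space n) r, ‖z‖ ^ 2 / ‖z‖ ^ (n + 1) < e := by
  have h := Antitone.tendsto_setIntegral (μ := (volume : Measure (Space n)))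
    (s := fun k : ℕ => Metric.ball (0 : Space n) (1 / ((k : ℝ) + 1)))
    (f := fun z => ‖z‖ ^ 2 / ‖z‖ ^ (n + 1))
    (fun i => measurableSet_ball)
    (fun i j hij => Metric.ball_subset_ball (Nat.one_div_le_one_div hij))
    (integrableOn_kernel_near n _)
  have hinter : (⋂ k : ℕ, Metric.ball (0 : Space n) (1 / ((k : ℝ) + 1))) = {0} := by
    refine subset_antisymm (fun z hz => ?_) ?_
    · by_contra hz0
      obtain ⟨k, hk⟩ := exists_nat_one_div_lt (norm_pos_iff.2 hz0)
      have := mem_iInter.1 hz k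
      rw [mem_ball_zero_iff] at this
      linarith
    · rintro z rfl
      exact mem_iInter.2 fun k => Metric.mem_ball_self (by positivity)
  rw [hinter, integral_singleton] at h
  simp only [norm_zero, ne_eq, OfNat.ofNat_ne_zero, not_false_eq_true, zero_pow, zero_div,
    smul_zero] at h
  obtain ⟨k, hk, hkR⟩ := ((h.eventually (gt_mem_nhds he)).and
    ((tendsto_one_div_add_atTop_nhds_zero_nat (𝕜 := ℝ)).eventually (gt_mem_nhds hR))).exists
  exact ⟨_, by positivity, hkR, hk⟩

/-! ### Comparing two half Laplacians -/

theorem halfLaplacianConst_nonneg (n : ℕ) : 0 ≤ halfLaplacianConst n :=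
  div_nonneg (Real.Gamma_pos_of_pos (by positivity)).le (by positivity)

/-- The region `ρ < ‖z‖` is symmetric, so a lower bound for the even part of `F` suffices. In
particular terms linear in `z` can be dropped. -/
theorem neg_integral_le_setIntegral_of_symm {n : ℕ} {F k : Space n → ℝ} {ρ : ℝ}
    (hF : IntegrableOn F {z | ρ < ‖z‖} volume) (hk : Integrable k volume) (hk0 : ∀ z, 0 ≤ k z)
    (h : ∀ z, -(2 * k z) ≤ F z + F (-z)) :
    -∫ z, k z ≤ ∫ z in {z | ρ < ‖z‖}, F z := by
  set S : Set (Space n) := {z | ρ < ‖z‖} with hS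
  have hSm : MeasurableSet S := measurableSet_lt measurable_const measurable_norm
  have hSneg : -S = S := by ext z; simp [hS]
  have hF' : IntegrableOn (fun z => F (-z)) S volume := by
    have := hF.comp_neg
    rwa [hSneg] at this
  have hsymm : ∫ z in S, F (-z) = ∫ z in S, F z := by
    rw [← integral_indicator hSm, ← integral_indicator hSm, ← integral_neg_eq_self]
    congr 1
    funext z
    by_cases hz : z ∈ S
    · have : -z ∈ S := by rw [← hSneg]; simpa using hz
      simp [hz, this]
    · have : -z ∉ S := by rw [← hSneg]; simpa using hz
      simp [hz, this]
  have h1 : ∫ z in S, -(2 * k z) ≤ ∫ z in S, (F z + F (-z)) :=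
    integral_mono (hk.const_mul 2).neg.integrableOn (hF.add hF') h
  rw [integral_neg, integral_const_mul, integral_add hF hF', hsymm] at h1
  have h2 : ∫ z in S, k z ≤ ∫ z, k z :=
    setIntegral_le_integral hk (Eventually.of_forall hk0)
  linarith

/-- Two half Laplacians are compared through a lower bound for the even part, in the shift `z`, of
the difference of the increments. -/
theorem HasHalfLaplacian.sub_le {n : ℕ} {f g k : Space n → ℝ} {x y : Space n} {L L' : ℝ}
    (hf : HasHalfLaplacian f x L) (hg : HasHalfLaplacian g y L') (hk : Integrable k volume)
    (hk0 : ∀ z, 0 ≤ k z)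
    (h : ∀ z, -(2 * k z) ≤
      (((f x - f (x + z)) - (g y - g (y + z))) +
        ((f x - f (x - z)) - (g y - g (y - z)))) / ‖z‖ ^ (n + 1)) :
    L' - L ≤ halfLaplacianConst n * ∫ z, k z := by
  have hlim := hf.2.sub hg.2
  have : -(halfLaplacianConst n * ∫ z, k z) ≤ L - L' := by
    refine ge_of_tendsto hlim ?_
    filter_upwards [self_mem_nhdsWithin] with ρ hρ
    rw [← mul_sub, ← integral_sub (hf.1 ρ hρ) (hg.1 ρ hρ), ← mul_neg]
    refine mul_le_mul_of_nonneg_left ?_ (halfLaplacianConst_nonneg n)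
    refine neg_integral_le_setIntegral_of_symm ((hf.1 ρ hρ).sub (hg.1 ρ hρ)) hk hk0 fun z => ?_
    refine (h z).trans_eq ?_
    simp only [norm_neg, ← sub_eq_add_neg]
    ring
  linarith

/-! ### The penalization -/

/-- The bounded penalization `M δ ‖x‖² / (1 + δ ‖x‖²)`: it tends to `M` at infinity, while its
derivatives are small when `δ` is. -/
noncomputable def penalty {n : ℕ} (M δ : ℝ) (x : Space n) : ℝ :=
  M * (δ * ‖x‖ ^ 2) / (1 + δ * ‖x‖ ^ 2)

/-- The gradient of `penalty M δ`. -/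
noncomputable def penaltyGrad {n : ℕ} (M δ : ℝ) (x : Space n) : Space n :=
  (2 * M * δ / (1 + δ * ‖x‖ ^ 2) ^ 2) • x

section Penalty

variable {n : ℕ} {M δ : ℝ}

theorem penalty_nonneg (hM : 0 ≤ M) (hδ : 0 ≤ δ) (x : Space n) : 0 ≤ penalty M δ x := by
  unfold penalty; positivity

theorem penalty_le (hM : 0 ≤ M) (hδ : 0 ≤ δ) (x : Space n) : penalty M δ x ≤ M := by
  unfold penalty
  rw [div_le_iff₀ (by positivity)]
  nlinarith

theorem penalty_le_mul_norm_sq (hM : 0 ≤ M) (hδ : 0 ≤ δ) (x : Space n) :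
    penalty M δ x ≤ M * δ * ‖x‖ ^ 2 := by
  unfold penalty
  rw [← mul_assoc]
  exact div_le_self (by positivity) (by nlinarith [mul_nonneg hδ (sq_nonneg ‖x‖)])

/-- The penalization is semiconcave, with a constant proportional to `δ`. -/
theorem penalty_add_le (hM : 0 ≤ M) (hδ : 0 ≤ δ) (x z : Space n) :
    penalty M δ (x + z) ≤
      penalty M δ x + inner ℝ (penaltyGrad M δ x) z + M * δ * ‖z‖ ^ 2 := by
  have hq : ‖x + z‖ ^ 2 = ‖x‖ ^ 2 + 2 * inner ℝ x z + ‖z‖ ^ 2 := norm_add_sq_real x z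
  unfold penalty penaltyGrad
  rw [real_inner_smul_left]
  set q := ‖x‖ ^ 2
  set q' := ‖x + z‖ ^ 2
  set i := inner ℝ x z
  set w := ‖z‖ ^ 2
  have hq0 : 0 ≤ q := by positivity
  have hq0' : 0 ≤ q' := by positivity
  have hw0 : 0 ≤ w := by positivity
  have ha : 0 < 1 + δ * q := by positivity
  have hb : 0 < 1 + δ * q' := by positivity
  -- `s ↦ s / (1 + s)` is concave, hence lies below its tangent line
  have h1 : M * (δ * q') / (1 + δ * q') ≤
      M * (δ * q) / (1 + δ * q) + M * δ * (q' - q) / (1 + δ * q) ^ 2 := by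
    have : M * (δ * q) / (1 + δ * q) + M * δ * (q' - q) / (1 + δ * q) ^ 2
        - M * (δ * q') / (1 + δ * q') =
        M * (δ * (q' - q)) ^ 2 / ((1 + δ * q) ^ 2 * (1 + δ * q')) := by
      field_simp
      ring
    have h0 : 0 ≤ M * (δ * (q' - q)) ^ 2 / ((1 + δ * q) ^ 2 * (1 + δ * q')) := by positivity
    linarith
  have h2 : M * δ * (q' - q) / (1 + δ * q) ^ 2 =
      2 * M * δ / (1 + δ * q) ^ 2 * i + M * δ * w / (1 + δ * q) ^ 2 := by
    rw [hq]; ring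
  have h3 : M * δ * w / (1 + δ * q) ^ 2 ≤ M * δ * w :=
    div_le_self (by positivity) (one_le_pow₀ (by nlinarith [mul_nonneg hδ hq0]))
  linarith

theorem norm_penaltyGrad_le (hM : 0 ≤ M) (hδ : 0 ≤ δ) (x : Space n) :
    ‖penaltyGrad M δ x‖ ≤ M * √δ := by
  unfold penaltyGrad
  rw [norm_smul, Real.norm_of_nonneg (by positivity), div_mul_eq_mul_div,
    div_le_iff₀ (by positivity)]
  have hs : √δ ^ 2 = δ := Real.sq_sqrt hδ
  set s := √δ
  have hs0 : 0 ≤ s := Real.sqrt_nonneg _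
  rw [← hs]
  set a := s * ‖x‖ with ha
  have h1 : 2 * a ≤ (1 + a ^ 2) ^ 2 := by nlinarith [sq_nonneg (a - 1), sq_nonneg (a ^ 2)]
  have h2 := mul_le_mul_of_nonneg_left h1 (mul_nonneg hM hs0)
  calc 2 * M * s ^ 2 * ‖x‖ = M * s * (2 * a) := by rw [ha]; ring
    _ ≤ M * s * (1 + a ^ 2) ^ 2 := h2
    _ = M * s * (1 + s ^ 2 * ‖x‖ ^ 2) ^ 2 := by rw [ha]; ring

theorem contDiff_penalty (hδ : 0 ≤ δ) : ContDiff ℝ 2 (penalty M δ : Space n → ℝ) := by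
  unfold penalty
  refine ContDiff.div (contDiff_const.mul (contDiff_const.mul (contDiff_norm_sq ℝ)))
    (contDiff_const.add (contDiff_const.mul (contDiff_norm_sq ℝ))) fun x => ?_
  positivity

theorem hasGradientAt_penalty (hδ : 0 ≤ δ) (x : Space n) :
    HasGradientAt (penalty M δ) (penaltyGrad M δ x) x := by
  have hpos : 1 + δ * ‖x‖ ^ 2 ≠ 0 := by positivity
  have h1 := ((hasDerivAt_id (‖x‖ ^ 2)).const_mul δ).const_mul M
  have h2 := ((hasDerivAt_id (‖x‖ ^ 2)).const_mul δ).const_add 1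
  rw [hasGradientAt_iff_hasFDerivAt]
  refine ((h1.div h2 hpos).comp_hasFDerivAt x
    (hasStrictFDerivAt_norm_sq x).hasFDerivAt).congr_fderiv ?_
  ext z
  simp [penaltyGrad]
  field_simp
  ring

theorem penalty_gt_of_norm_gt (hδ : 0 < δ) {B : ℝ} {x : Space n}
    (hx : B < (M - B) * (δ * ‖x‖ ^ 2)) : B < penalty M δ x := by
  unfold penalty
  rw [lt_div_iff₀ (by positivity)]
  linarith

end Penalty

/-! ### Test functions -/

/-- The operator evaluated at a glued function only sees the derivatives of the test function. -/
theorem HasOperatorValue.exists_of_glue {n : ℕ} {H : Space n → ℝ} {φ u : Space n × ℝ → ℝ}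
    {x p : Space n} {t r a τ : ℝ} (h : HasOperatorValue H (glue φ u x t r) x t a) (hr : 0 < r)
    (hp : HasGradientAt (fun y => φ (y, t)) p x) (hτ : HasDerivAt (fun s => φ (x, s)) τ t) :
    ∃ L : ℝ, HasHalfLaplacian (fun y => glue φ u x t r (y, t)) x L ∧ a = τ + H p + L := by
  obtain ⟨L, hL, ha⟩ := h
  refine ⟨L, hL, ?_⟩
  have h1 : (fun s => glue φ u x t r (x, s)) =ᶠ[𝓝 t] fun s => φ (x, s) := by
    filter_upwards [Ioo_mem_nhds (show t - r < t by linarith) (show t < t + r by linarith)]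
      with s hs
    simp [glue, hr, hs.1, hs.2]
  have h2 : (fun y => glue φ u x t r (y, t)) =ᶠ[𝓝 x] fun y => φ (y, t) := by
    filter_upwards [Metric.ball_mem_nhds x hr] with y hy
    rw [Metric.mem_ball', dist_eq_norm] at hy
    simp [glue, hr, hy]
  rw [ha, h1.deriv_eq, hτ.deriv, h2.gradient.self_of_nhds, hp.gradient]

theorem glue_self {n : ℕ} {φ u : Space n × ℝ → ℝ} {x : Space n} {t r : ℝ} (hr : 0 < r) :
    glue φ u x t r (x, t) = φ (x, t) := by
  simp [glue, hr]

theorem glue_add_of_lt {n : ℕ} {φ u : Space n × ℝ → ℝ} {x z : Space n} {t r : ℝ} (hr : 0 < r)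
    (hz : ‖z‖ < r) : glue φ u x t r (x + z, t) = φ (x + z, t) := by
  simp [glue, hr, hz]

theorem glue_add_of_le {n : ℕ} {φ u : Space n × ℝ → ℝ} {x z : Space n} {t r : ℝ}
    (hz : r ≤ ‖z‖) : glue φ u x t r (x + z, t) = u (x + z, t) := by
  simp [glue, not_lt.2 hz]

theorem hasGradientAt_norm_sub_sq_div {n : ℕ} (a x : Space n) (ε : ℝ) :
    HasGradientAt (fun y => ‖y - a‖ ^ 2 / (2 * ε)) (ε⁻¹ • (x - a)) x := by
  have h := (((hasFDerivAt_id (𝕜 := ℝ) x).sub_const a).norm_sq).mul_const ((2 * ε)⁻¹)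
  rw [hasGradientAt_iff_hasFDerivAt]
  refine (h.congr_of_eventuallyEq (Eventually.of_forall fun y => ?_)).congr_fderiv ?_
  · simp [div_eq_mul_inv]
  · ext z
    simp
    ring

theorem hasDerivAt_sub_sq_div (a t ε : ℝ) :
    HasDerivAt (fun s => (s - a) ^ 2 / (2 * ε)) (ε⁻¹ * (t - a)) t := by
  have h := (((hasDerivAt_id t).sub_const a).pow 2).div_const (2 * ε)
  refine h.congr_deriv ?_
  simp
  rw [mul_div_mul_left _ _ two_ne_zero, div_eq_inv_mul]

/-! ### Doubling of variables -/

/-- The functional whose maximum is studied; `η` penalizes late times and `penalty M δ` makes the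
maximum exist. -/
noncomputable def doubled {n : ℕ} (u v : Space n × ℝ → ℝ) (ε η M δ : ℝ)
    (a b : Space n × ℝ) : ℝ :=
  u a - v b - ‖a.1 - b.1‖ ^ 2 / (2 * ε) - (a.2 - b.2) ^ 2 / (2 * ε) - η * a.2 - penalty M δ a.1

/-- The strip `ℝⁿ × [0, T]`. -/
def strip (n : ℕ) (T : ℝ) : Set (Space n × ℝ) := {a | 0 ≤ a.2 ∧ a.2 ≤ T}

/-- The doubled functional attains its maximum: the penalization confines `x`, and then the
quadratic term confines `y`. -/
theorem exists_isMax_doubled {n : ℕ} {u v : Space n × ℝ → ℝ} {T ε η M δ B : ℝ}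
    (hu : UpperSemicontinuousOn u (spaceTime n)) (hv : LowerSemicontinuousOn v (spaceTime n))
    (hε : 0 < ε) (hη : 0 ≤ η) (hδ : 0 < δ) (hB : 0 ≤ B) (hM : B < M)
    (hbdd : ∀ a ∈ strip n T, ∀ b ∈ strip n T, u a - v b ≤ B)
    {a₀ b₀ : Space n × ℝ} (ha₀ : a₀ ∈ strip n T) (hb₀ : b₀ ∈ strip n T)
    (h₀ : 0 < doubled u v ε η M δ a₀ b₀) :
    ∃ a ∈ strip n T, ∃ b ∈ strip n T, ∀ a' ∈ strip n T, ∀ b' ∈ strip n T,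
      doubled u v ε η M δ a' b' ≤ doubled u v ε η M δ a b := by
  have hMB : 0 < (M - B) * δ := mul_pos (by linarith) hδ
  set R : ℝ := B / ((M - B) * δ) + 1 with hR
  have hR1 : 1 ≤ R := by rw [hR]; have := div_nonneg hB hMB.le; linarith
  have hR2 : B < (M - B) * δ * R := by
    rw [hR, mul_add, mul_div_cancel₀ _ hMB.ne']; linarith
  set R' : ℝ := R + (2 * ε * B + 1) with hR'
  set K : Set ((Space n × ℝ) × (Space n × ℝ)) :=
    (Metric.closedBall 0 R ×ˢ Icc 0 T) ×ˢ (Metric.closedBall 0 R' ×ˢ Icc 0 T) with hK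
  have hKc : IsCompact K :=
    ((isCompact_closedBall _ _).prod isCompact_Icc).prod
      ((isCompact_closedBall _ _).prod isCompact_Icc)
  -- the functional is nonpositive outside `K`
  have hout : ∀ a ∈ strip n T, ∀ b ∈ strip n T, 0 < doubled u v ε η M δ a b → (a, b) ∈ K := by
    intro a ha b hb hpos
    have h1 := hbdd a ha b hb
    have h2 : 0 ≤ (a.2 - b.2) ^ 2 / (2 * ε) := by positivity
    have h3 : 0 ≤ η * a.2 := mul_nonneg hη ha.1
    have h4 : 0 ≤ ‖a.1 - b.1‖ ^ 2 / (2 * ε) := by positivity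
    have h5 := penalty_nonneg (M := M) (by linarith) hδ.le a.1
    unfold doubled at hpos
    have hx : ‖a.1‖ ≤ R := by
      by_contra! hx
      have : B < penalty M δ a.1 := by
        refine penalty_gt_of_norm_gt hδ (hR2.trans_le ?_)
        rw [← mul_assoc]
        refine mul_le_mul_of_nonneg_left ?_ hMB.le
        nlinarith
      linarith
    have hy : ‖b.1‖ ≤ R' := by
      by_contra! hy
      have h6 : 2 * ε * B + 1 < ‖a.1 - b.1‖ := by
        have := norm_sub_norm_le b.1 a.1
        rw [norm_sub_rev] at this
        linarith
      have h7 : B < ‖a.1 - b.1‖ ^ 2 / (2 * ε) := by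
        rw [lt_div_iff₀ (by positivity)]
        have : 0 ≤ 2 * ε * B := by positivity
        nlinarith
      linarith
    exact ⟨⟨mem_closedBall_zero_iff.2 hx, ha⟩, ⟨mem_closedBall_zero_iff.2 hy, hb⟩⟩
  have husc : UpperSemicontinuousOn
      (fun z : (Space n × ℝ) × (Space n × ℝ) => doubled u v ε η M δ z.1 z.2) K := by
    have e1 : UpperSemicontinuousOn (fun z : (Space n × ℝ) × (Space n × ℝ) => u z.1) K :=
      hu.comp continuousOn_fst fun z hz => hz.1.2.1
    have e2 : UpperSemicontinuousOn (fun z : (Space n × ℝ) × (Space n × ℝ) => -v z.2) K := by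
      have : LowerSemicontinuousOn (fun z : (Space n × ℝ) × (Space n × ℝ) => v z.2) K :=
        hv.comp continuousOn_snd fun z hz => hz.2.2.1
      intro z hz c hc
      filter_upwards [this z hz (-c) (by linarith)] with w hw
      linarith
    have e3 : Continuous fun z : (Space n × ℝ) × (Space n × ℝ) =>
        - ‖z.1.1 - z.2.1‖ ^ 2 / (2 * ε) - (z.1.2 - z.2.2) ^ 2 / (2 * ε) - η * z.1.2
          - penalty M δ z.1.1 := by
      have := (contDiff_penalty (n := n) (M := M) hδ.le).continuous
      fun_prop
    have := (e1.add e2).add e3.continuousOn.upperSemicontinuousOn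
    refine (congrArg (UpperSemicontinuousOn · K) (funext fun z => ?_)).mp this
    simp only [doubled]
    ring
  obtain ⟨z, hz, hmax⟩ := husc.exists_isMaxOn ⟨_, hout a₀ ha₀ b₀ hb₀ h₀⟩ hKc
  refine ⟨z.1, hz.1.2, z.2, hz.2.2, fun a' ha' b' hb' => ?_⟩
  have hz0 : 0 < doubled u v ε η M δ z.1 z.2 := h₀.trans_le (hmax (hout a₀ ha₀ b₀ hb₀ h₀))
  by_cases hpos : 0 < doubled u v ε η M δ a' b'
  · exact hmax (hout a' ha' b' hb' hpos)
  · linarith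

/-- The error density in the comparison of the two half Laplacians at a maximum point. -/
noncomputable def errorDensity (n : ℕ) (ε M δ A r : ℝ) (z : Space n) : ℝ :=
  (Metric.ball 0 A).indicator (fun z : Space n => M * δ * (‖z‖ ^ 2 / ‖z‖ ^ (n + 1))) z +
    (Metric.ball 0 r).indicator (fun z : Space n => ε⁻¹ * (‖z‖ ^ 2 / ‖z‖ ^ (n + 1))) z +
    {z : Space n | A ≤ ‖z‖}.indicator (fun z : Space n => M * (1 / ‖z‖ ^ (n + 1))) z

section ErrorDensity

variable {n : ℕ} {ε M δ A r : ℝ}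

theorem errorDensity_nonneg (hε : 0 < ε) (hM : 0 ≤ M) (hδ : 0 ≤ δ) (z : Space n) :
    0 ≤ errorDensity n ε M δ A r z := by
  unfold errorDensity
  refine add_nonneg (add_nonneg ?_ ?_) ?_ <;>
  · refine indicator_nonneg (fun z _ => ?_) z
    positivity

theorem measurableSet_le_norm (n : ℕ) (A : ℝ) : MeasurableSet {z : Space n | A ≤ ‖z‖} :=
  measurableSet_le measurable_const measurable_norm

theorem integrable_errorDensity (hA : 0 < A) : Integrable (errorDensity n ε M δ A r) volume :=
  ((IntegrableOn.integrable_indicator ((integrableOn_kernel_near n A).const_mul (M * δ))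
    measurableSet_ball).add
    (IntegrableOn.integrable_indicator ((integrableOn_kernel_near n r).const_mul ε⁻¹)
      measurableSet_ball)).add
    (IntegrableOn.integrable_indicator ((integrableOn_kernel_far n hA).const_mul M)
      (measurableSet_le_norm n A))

theorem integral_errorDensity (hA : 0 < A) :
    ∫ z, errorDensity n ε M δ A r z =
      M * δ * (∫ z in Metric.ball (0 : Space n) A, ‖z‖ ^ 2 / ‖z‖ ^ (n + 1)) +
      ε⁻¹ * (∫ z in Metric.ball (0 : Space n) r, ‖z‖ ^ 2 / ‖z‖ ^ (n + 1)) +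
      M * ∫ z in {z : Space n | A ≤ ‖z‖}, 1 / ‖z‖ ^ (n + 1) := by
  have h1 := IntegrableOn.integrable_indicator ((integrableOn_kernel_near n A).const_mul (M * δ))
    measurableSet_ball
  have h2 := IntegrableOn.integrable_indicator ((integrableOn_kernel_near n r).const_mul ε⁻¹)
    measurableSet_ball
  have h3 := IntegrableOn.integrable_indicator ((integrableOn_kernel_far n hA).const_mul M)
    (measurableSet_le_norm n A)
  have h := integral_add (h1.add h2) h3
  simp only [Pi.add_apply] at h
  unfold errorDensity
  rw [h, integral_add h1 h2, integral_indicator measurableSet_ball,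
    integral_indicator measurableSet_ball, integral_indicator (measurableSet_le_norm n A),
    integral_const_mul, integral_const_mul, integral_const_mul]

/-- A pointwise lower bound for `W`: second order inside the ball of radius `r`, governed by the
penalization everywhere, gives a lower bound for the even part of `W`. -/
theorem neg_errorDensity_le {W : Space n → ℝ} {x : Space n} (hM : 0 ≤ M) (hδ : 0 ≤ δ)
    (hr : r ≤ A)
    (hin : ∀ z, ‖z‖ < r → penalty M δ x - penalty M δ (x + z) - ε⁻¹ * ‖z‖ ^ 2 ≤ W z)
    (hout : ∀ z, r ≤ ‖z‖ → penalty M δ x - penalty M δ (x + z) ≤ W z) (z : Space n) :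
    -(2 * errorDensity n ε M δ A r z) ≤ (W z + W (-z)) / ‖z‖ ^ (n + 1) := by
  have hP := penalty_add_le hM hδ x z
  have hP' := penalty_add_le hM hδ x (-z)
  rw [inner_neg_right, norm_neg] at hP'
  rcases lt_or_ge ‖z‖ A with hzA | hzA
  · have hA1 : z ∈ Metric.ball (0 : Space n) A := mem_ball_zero_iff.2 hzA
    have hA2 : z ∉ {z : Space n | A ≤ ‖z‖} := not_le.2 hzA
    rcases lt_or_ge ‖z‖ r with hzr | hzr
    · have hr1 : z ∈ Metric.ball (0 : Space n) r := mem_ball_zero_iff.2 hzr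
      have i1 := hin z hzr
      have i2 := hin (-z) (by rwa [norm_neg])
      rw [norm_neg] at i2
      simp only [errorDensity, indicator_of_mem hA1, indicator_of_mem hr1,
        indicator_of_notMem hA2]
      rw [show -(2 * (M * δ * (‖z‖ ^ 2 / ‖z‖ ^ (n + 1)) + ε⁻¹ * (‖z‖ ^ 2 / ‖z‖ ^ (n + 1)) + 0)) =
        (-(2 * (M * δ * ‖z‖ ^ 2 + ε⁻¹ * ‖z‖ ^ 2))) / ‖z‖ ^ (n + 1) by ring]
      refine div_le_div_of_nonneg_right ?_ (by positivity)
      linarith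
    · have hr1 : z ∉ Metric.ball (0 : Space n) r := by simpa using hzr
      have i1 := hout z hzr
      have i2 := hout (-z) (by rwa [norm_neg])
      simp only [errorDensity, indicator_of_mem hA1, indicator_of_notMem hr1,
        indicator_of_notMem hA2]
      rw [show -(2 * (M * δ * (‖z‖ ^ 2 / ‖z‖ ^ (n + 1)) + 0 + 0)) =
        (-(2 * (M * δ * ‖z‖ ^ 2))) / ‖z‖ ^ (n + 1) by ring]
      refine div_le_div_of_nonneg_right ?_ (by positivity)
      linarith
  · have hA1 : z ∉ Metric.ball (0 : Space n) A := by simpa using hzA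
    have hA2 : z ∈ {z : Space n | A ≤ ‖z‖} := hzA
    have hr1 : z ∉ Metric.ball (0 : Space n) r := by simpa using hr.trans hzA
    have i1 := hout z (hr.trans hzA)
    have i2 := hout (-z) (by rw [norm_neg]; exact hr.trans hzA)
    have b1 := penalty_nonneg hM hδ x
    have b2 := penalty_le hM hδ (x + z)
    have b3 := penalty_le hM hδ (x + -z)
    simp only [errorDensity, indicator_of_notMem hA1, indicator_of_notMem hr1,
      indicator_of_mem hA2]
    rw [show -(2 * (0 + 0 + M * (1 / ‖z‖ ^ (n + 1)))) = (-(2 * M)) / ‖z‖ ^ (n + 1) by ring]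
    refine div_le_div_of_nonneg_right ?_ (by positivity)
    linarith

end ErrorDensity

/-- The inequality obtained by subtracting the two equations at an interior maximum of the doubled
functional. The parts of the half Laplacians outside `B_r` are compared through the maximum
property under a common shift of `x` and `y`. -/
theorem le_of_isMax_doubled {n : ℕ} {H : Space n → ℝ} {u v : Space n × ℝ → ℝ}
    {T ε η M δ A r : ℝ} {x y : Space n} {t s : ℝ}
    (hu : IsViscositySubsolution H u) (hv : IsViscositySupersolution H v)
    (hε : 0 < ε) (hM : 0 ≤ M) (hδ : 0 ≤ δ) (hA : 0 < A) (hr : 0 < r) (hrA : r ≤ A)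
    (ht : 0 < t) (htT : t ≤ T) (hs : 0 < s) (hsT : s ≤ T)
    (hmax : ∀ a ∈ strip n T, ∀ b ∈ strip n T,
      doubled u v ε η M δ a b ≤ doubled u v ε η M δ (x, t) (y, s)) :
    η + H (ε⁻¹ • (x - y) + penaltyGrad M δ x) - H (ε⁻¹ • (x - y)) ≤
      halfLaplacianConst n * ∫ z, errorDensity n ε M δ A r z := by
  set m := doubled u v ε η M δ (x, t) (y, s) with hm
  have hm' := hm
  simp only [doubled] at hm'
  have hpen := contDiff_penalty (n := n) (M := M) hδ
  set φ : Space n × ℝ → ℝ := fun a =>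
    ‖a.1 - y‖ ^ 2 / (2 * ε) + penalty M δ a.1 + ((a.2 - s) ^ 2 / (2 * ε) + η * a.2)
      + (v (y, s) + m) with hφ
  set ψ : Space n × ℝ → ℝ := fun b =>
    -(‖b.1 - x‖ ^ 2 / (2 * ε) + (b.2 - t) ^ 2 / (2 * ε))
      + (u (x, t) - η * t - penalty M δ x - m) with hψ
  have hφc : ContDiff ℝ 2 φ := by
    have h1 : ContDiff ℝ 2 fun a : Space n × ℝ => ‖a.1 - y‖ ^ 2 :=
      (contDiff_fst.sub contDiff_const).norm_sq ℝ
    have h2 : ContDiff ℝ 2 fun a : Space n × ℝ => penalty M δ a.1 := hpen.comp contDiff_fst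
    fun_prop
  have hψc : ContDiff ℝ 2 ψ := by
    have h1 : ContDiff ℝ 2 fun a : Space n × ℝ => ‖a.1 - x‖ ^ 2 :=
      (contDiff_fst.sub contDiff_const).norm_sq ℝ
    fun_prop
  have hφt : TouchesFromAbove φ u x t r := by
    refine ⟨by simp only [hφ]; linarith, fun x' t' _ _ h1 h2 => ?_⟩
    have := hmax (x', t') ⟨h2, h1.trans htT⟩ (y, s) ⟨hs.le, hsT⟩
    simp only [doubled] at this
    simp only [hφ]
    linarith
  have hψt : TouchesFromBelow ψ v y s r := by
    have hsymm : ∀ y' : Space n, ∀ s' : ℝ, ‖y' - x‖ = ‖x - y'‖ ∧ (s' - t) ^ 2 = (t - s') ^ 2 :=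
      fun y' s' => ⟨norm_sub_rev _ _, by ring⟩
    refine ⟨by simp only [hψ, (hsymm y s).1, (hsymm y s).2]; linarith,
      fun y' s' _ _ h1 h2 => ?_⟩
    have := hmax (x, t) ⟨ht.le, htT⟩ (y', s') ⟨h2, h1.trans hsT⟩
    simp only [doubled] at this
    simp only [hψ, (hsymm y' s').1, (hsymm y' s').2]
    linarith
  obtain ⟨a, ha, ha0⟩ := hu.2 φ x t r hφc ht hr hφt
  obtain ⟨b, hb, hb0⟩ := hv.2 ψ y s r hψc hs hr hψt
  have hφx : HasGradientAt (fun x' => φ (x', t)) (ε⁻¹ • (x - y) + penaltyGrad M δ x) x := by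
    have h1 := (hasGradientAt_norm_sub_sq_div y x ε).hasFDerivAt
    have h2 := (hasGradientAt_penalty (M := M) hδ x).hasFDerivAt
    rw [hasGradientAt_iff_hasFDerivAt, map_add]
    exact ((h1.fun_add h2).add_const ((t - s) ^ 2 / (2 * ε) + η * t)).add_const (v (y, s) + m)
  have hφs : HasDerivAt (fun t' => φ (x, t')) (ε⁻¹ * (t - s) + η) t := by
    have h1 := (hasDerivAt_sub_sq_div s t ε).fun_add ((hasDerivAt_id t).const_mul η)
    rw [mul_one] at h1
    exact (h1.const_add (‖x - y‖ ^ 2 / (2 * ε) + penalty M δ x)).add_const (v (y, s) + m)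
  have hψx : HasGradientAt (fun y' => ψ (y', s)) (ε⁻¹ • (x - y)) y := by
    have h1 := (hasGradientAt_norm_sub_sq_div x y ε).hasFDerivAt
    rw [hasGradientAt_iff_hasFDerivAt, ← neg_sub y x, smul_neg, map_neg]
    exact (h1.add_const ((s - t) ^ 2 / (2 * ε))).fun_neg.add_const
      (u (x, t) - η * t - penalty M δ x - m)
  have hψs : HasDerivAt (fun s' => ψ (y, s')) (ε⁻¹ * (t - s)) s := by
    have h1 := hasDerivAt_sub_sq_div t s ε
    rw [← neg_sub s t, mul_neg]
    exact (h1.const_add (‖y - x‖ ^ 2 / (2 * ε))).fun_neg.add_const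
      (u (x, t) - η * t - penalty M δ x - m)
  obtain ⟨L, hL, haL⟩ := ha.exists_of_glue hr hφx hφs
  obtain ⟨L', hL', hbL⟩ := hb.exists_of_glue hr hψx hψs
  have hkey : L' - L ≤ halfLaplacianConst n * ∫ z, errorDensity n ε M δ A r z := by
    refine hL.sub_le hL' (integrable_errorDensity hA) (errorDensity_nonneg hε hM hδ) ?_
    simp only [sub_eq_add_neg _ (_ : Space n)]
    refine neg_errorDensity_le (W := fun z => (glue φ u x t r (x, t) - glue φ u x t r (x + z, t))
      - (glue ψ v y s r (y, s) - glue ψ v y s r (y + z, s))) (x := x) hM hδ hrA ?_ ?_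
    · intro z hz
      simp only [glue_self hr, glue_add_of_lt hr hz, hφ, hψ]
      have e1 : ‖x + z - y‖ ^ 2 = ‖x - y‖ ^ 2 + 2 * inner ℝ (x - y) z + ‖z‖ ^ 2 := by
        rw [← norm_add_sq_real]; congr 2; abel
      have e2 : ‖y + z - x‖ ^ 2 = ‖x - y‖ ^ 2 - 2 * inner ℝ (x - y) z + ‖z‖ ^ 2 := by
        rw [← norm_sub_sq_real, ← norm_neg]; congr 2; abel
      rw [e1, e2, norm_sub_rev y x]
      refine le_of_eq ?_
      field_simp
      ring
    · intro z hz
      simp only [glue_self hr, glue_add_of_le hz, hφt.1, hψt.1]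
      have := hmax (x + z, t) ⟨ht.le, htT⟩ (y + z, s) ⟨hs.le, hsT⟩
      rw [hm] at this
      simp only [doubled, add_sub_add_right_eq_sub] at this
      linarith
  linarith

/-! ### Conclusion -/

theorem exists_pos_forall_lt_mul_lt {c e : ℝ} (hc : 0 ≤ c) (he : 0 < e) :
    ∃ d : ℝ, 0 < d ∧ ∀ x : ℝ, x < d → c * x < e := by
  refine ⟨e / (c + 1), by positivity, fun x hx => ?_⟩
  rw [lt_div_iff₀ (by positivity)] at hx
  rcases le_or_gt x 0 with h | h
  · exact (mul_nonpos_of_nonneg_of_nonpos hc h).trans_lt he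
  · linarith

theorem propositionp (n : ℕ) (H : Space n → ℝ) (hH : LocallyLipschitz H)
    (u v : Space n × ℝ → ℝ)
    (hu : IsViscositySubsolution H u) (hv : IsViscositySupersolution H v)
    (hu_bdd : ∀ T : ℝ, ∃ C : ℝ, ∀ (x : Space n) (t : ℝ), 0 ≤ t → t ≤ T → u (x, t) ≤ C)
    (hv_bdd : ∀ T : ℝ, ∃ C : ℝ, ∀ (x : Space n) (t : ℝ), 0 ≤ t → t ≤ T → C ≤ v (x, t))
    (h_init : ∀ ε : ℝ, 0 < ε → ∃ δ : ℝ, 0 < δ ∧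
      ∀ (x y : Space n) (t s : ℝ), 0 ≤ t → 0 ≤ s →
        ‖x - y‖ < δ → |t| < δ → |s| < δ → u (x, t) ≤ v (y, s) + ε) :
    ∀ (x : Space n) (t : ℝ), 0 ≤ t → u (x, t) ≤ v (x, t) := by
  intro x₀ T hT
  by_contra! hlt
  obtain ⟨σ, hσ, hσ3⟩ : ∃ σ : ℝ, 0 < σ ∧ u (x₀, T) - v (x₀, T) = 3 * σ :=
    ⟨(u (x₀, T) - v (x₀, T)) / 3, by linarith, by ring⟩
  obtain ⟨Cu, hCu⟩ := hu_bdd T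
  obtain ⟨Cv, hCv⟩ := hv_bdd T
  obtain ⟨B, hB, hbdd⟩ : ∃ B : ℝ, 0 < B ∧ ∀ a ∈ strip n T, ∀ b ∈ strip n T, u a - v b ≤ B := by
    refine ⟨|Cu - Cv| + 1, by positivity, fun a ha b hb => ?_⟩
    have h1 := hCu a.1 a.2 ha.1 ha.2
    have h2 := hCv b.1 b.2 hb.1 hb.2
    have h3 := le_abs_self (Cu - Cv)
    linarith
  obtain ⟨η, hη, hηT⟩ : ∃ η : ℝ, 0 < η ∧ η * T ≤ σ := by
    refine ⟨σ / (T + 1), by positivity, ?_⟩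
    rw [div_mul_eq_mul_div, div_le_iff₀ (by positivity)]
    nlinarith
  set M := B + 1 with hMdef
  have hM : 0 ≤ M := by positivity
  -- `ε` is so small that the two points of a maximum are at distance less than `d`
  obtain ⟨d, hd, hinit⟩ := h_init σ hσ
  obtain ⟨ε, hε, hεd⟩ : ∃ ε : ℝ, 0 < ε ∧ 2 * ε * B < d ^ 2 := by
    refine ⟨d ^ 2 / (4 * B), by positivity, ?_⟩
    have : 2 * (d ^ 2 / (4 * B)) * B = d ^ 2 / 2 := by field_simp; norm_num
    rw [this]
    have : 0 < d ^ 2 := by positivity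
    linarith
  -- the gradients of the test functions stay in a ball depending on `ε` only
  have hunif : UniformContinuousOn H (Metric.closedBall 0 (ε⁻¹ * d + 1)) :=
    (isCompact_closedBall _ _).uniformContinuousOn_of_continuous hH.continuous.continuousOn
  obtain ⟨θ, hθ, hHθ⟩ := Metric.uniformContinuousOn_iff.1 hunif (η / 2) (by positivity)
  set c := halfLaplacianConst n with hc
  have hc0 : 0 ≤ c := halfLaplacianConst_nonneg n
  obtain ⟨e₁, he₁, hfar⟩ := exists_pos_forall_lt_mul_lt (mul_nonneg hc0 hM)
    (show 0 < η / 8 by positivity)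
  obtain ⟨A, hA, hAfar⟩ := exists_setIntegral_kernel_far_lt n he₁
  set I := ∫ z in Metric.ball (0 : Space n) A, ‖z‖ ^ 2 / ‖z‖ ^ (n + 1) with hI
  obtain ⟨δ, hδ, hδx, hδI, hδθ, hδ1⟩ : ∃ δ : ℝ, 0 < δ ∧ M * δ * ‖x₀‖ ^ 2 < σ ∧
      c * (M * δ * I) < η / 8 ∧ M * √δ < θ ∧ M * √δ < 1 := by
    have l1 : Tendsto (fun δ : ℝ => M * δ * ‖x₀‖ ^ 2) (𝓝[>] 0) (𝓝 (M * 0 * ‖x₀‖ ^ 2)) :=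
      (Continuous.tendsto (by fun_prop) 0).mono_left nhdsWithin_le_nhds
    have l2 : Tendsto (fun δ : ℝ => c * (M * δ * I)) (𝓝[>] 0) (𝓝 (c * (M * 0 * I))) :=
      (Continuous.tendsto (by fun_prop) 0).mono_left nhdsWithin_le_nhds
    have l3 : Tendsto (fun δ : ℝ => M * √δ) (𝓝[>] 0) (𝓝 (M * √0)) :=
      (Continuous.tendsto (by fun_prop) 0).mono_left nhdsWithin_le_nhds
    simp only [mul_zero, zero_mul, Real.sqrt_zero] at l1 l2 l3
    obtain ⟨δ, h0, h1, h2, h3, h4⟩ := (eventually_mem_nhdsWithin.and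
      ((l1.eventually (gt_mem_nhds hσ)).and
      ((l2.eventually (gt_mem_nhds (show 0 < η / 8 by positivity))).and
      ((l3.eventually (gt_mem_nhds hθ)).and (l3.eventually (gt_mem_nhds one_pos)))))).exists
    exact ⟨δ, h0, h1, h2, h3, h4⟩
  have hmem₀ : (x₀, T) ∈ strip n T := ⟨hT, le_rfl⟩
  have hbase : σ < doubled u v ε η M δ (x₀, T) (x₀, T) := by
    have := penalty_le_mul_norm_sq hM hδ.le x₀
    simp only [doubled, sub_self, norm_zero, ne_eq, OfNat.ofNat_ne_zero, not_false_eq_true,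
      zero_pow, zero_div, sub_zero]
    linarith
  obtain ⟨⟨x, t⟩, ha, ⟨y, s⟩, hb, hmax⟩ := exists_isMax_doubled hu.1 hv.1 hε hη.le hδ hB.le
    (show B < M by linarith) hbdd hmem₀ hmem₀ (hσ.trans hbase)
  have hval : σ < doubled u v ε η M δ (x, t) (y, s) :=
    hbase.trans_le (hmax _ hmem₀ _ hmem₀)
  have hB' := hbdd _ ha _ hb
  obtain ⟨ht0, htT⟩ : 0 ≤ t ∧ t ≤ T := ha
  obtain ⟨hs0, hsT⟩ : 0 ≤ s ∧ s ≤ T := hb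
  have hpen0 := penalty_nonneg hM hδ.le x
  have hηt : 0 ≤ η * t := by positivity
  have hq1 : 0 ≤ ‖x - y‖ ^ 2 / (2 * ε) := by positivity
  have hq2 : 0 ≤ (t - s) ^ 2 / (2 * ε) := by positivity
  simp only [doubled] at hval
  have hxy : ‖x - y‖ < d := by
    have h1 : ‖x - y‖ ^ 2 / (2 * ε) ≤ B := by linarith
    rw [div_le_iff₀ (by positivity)] at h1
    exact lt_of_pow_lt_pow_left₀ 2 hd.le (by linarith)
  have hts : |t - s| < d := by
    have h1 : (t - s) ^ 2 / (2 * ε) ≤ B := by linarith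
    rw [div_le_iff₀ (by positivity)] at h1
    exact abs_lt_of_sq_lt_sq (by linarith) hd.le
  -- the initial condition excludes a maximum at the initial time
  have hnot : ¬ (|t| < d ∧ |s| < d) := fun h => by
    have := hinit x y t s ht0 hs0 hxy h.1 h.2
    linarith
  have ht : 0 < t := by
    refine ht0.lt_of_ne' fun h => hnot ?_
    subst h
    exact ⟨by simpa using hd, by simpa using hts⟩
  have hs : 0 < s := by
    refine hs0.lt_of_ne' fun h => hnot ?_
    subst h
    exact ⟨by simpa using hts, by simpa using hd⟩
  obtain ⟨e₂, he₂, hnear⟩ := exists_pos_forall_lt_mul_lt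
    (mul_nonneg hc0 (inv_nonneg.2 hε.le)) (show 0 < η / 8 by positivity)
  obtain ⟨r, hr, hrA, hrI⟩ := exists_setIntegral_kernel_near_lt n he₂ hA
  have hfinal := le_of_isMax_doubled hu hv hε hM hδ.le hA hr hrA.le ht htT hs hsT hmax
  rw [integral_errorDensity hA, ← hc, ← hI] at hfinal
  have hf1 := hfar _ hAfar
  have hf2 := hnear _ hrI
  have hp : ‖ε⁻¹ • (x - y)‖ ≤ ε⁻¹ * d := by
    rw [norm_smul, Real.norm_of_nonneg (by positivity)]
    exact mul_le_mul_of_nonneg_left hxy.le (by positivity)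
  have hg := norm_penaltyGrad_le hM hδ.le x
  have hHd := hHθ (ε⁻¹ • (x - y) + penaltyGrad M δ x)
    (mem_closedBall_zero_iff.2 ((norm_add_le _ _).trans (by linarith)))
    (ε⁻¹ • (x - y)) (mem_closedBall_zero_iff.2 (by linarith))
    (by rw [dist_eq_norm, add_sub_cancel_left]; linarith)
  rw [Real.dist_eq] at hHd
  have := neg_lt_of_abs_lt hHd
  rw [mul_add, mul_add, ← mul_assoc c ε⁻¹, ← mul_assoc c M (∫ _ in _, _)] at hfinal
  linarith
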